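/- All rings are commutative with $1$, and a local ring is a nonzero ring with exactly one maximal ideal (not assumed Noetherian). A ring extension $R\subseteq S$ is called *Prüfer* if for every ring $T$ with $R\subseteq T\subseteq S$ the inclusion $R\subseteq T$ is a flat epimorphism of commutative rings. An element $x$ of a local ring $R$ is called a *strong divisor* if $x$ is regular (not a zero-divisor) and the principal ideal $Rx$ is comparable under inclusion with every ideal of $R$. For $x\in R$, let $R_x$ denote the localization of $R$ at the multiplicative set $\{1,x,x^2,\dots\}$. **Proposition.** Let $R$ be a local ring. 1. Let $R\subseteq S$ be a ring extension such that $S$ is of finite type (finitely generated) as an $R$-algebra. Then $R\subseteq S$ is Prüfer if and only if there is a strong divisor $s$ of $R$ such that $S=R_s$ (that is, $S\cong R_s$ as $R$-algebras). 2. Let $x\in R$ be a regular element. Then $x$ is a strong divisor of $R$ if and only if the extension $R\subseteq R_x$ is Prüfer. -/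

import Mathlib

/-- `R → S` is an injective homomorphism of commutative rings (an extension `R ⊆ S`) such that for
every intermediate ring `R ⊆ T ⊆ S` the map `R → T` is a flat epimorphism of commutative rings.
(`Algebra.IsEpi R T` is equivalent to `R → T` being an epimorphism in the category of commutative
rings, by `CommRingCat.epi_iff_epi`.) -/
structure IsPruferExtension (R : Type*) (S : Type*) [CommRing R] [CommRing S] [Algebra R S] :
    Prop where
  injective_algebraMap : Function.Injective (algebraMap R S)
  flat : ∀ T : Subalgebra R S, Module.Flat R T
  epi : ∀ T : Subalgebra R S, Algebra.IsEpi R T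

/-- A strong divisor of `R`: a regular element `x` such that the principal ideal `Rx` is comparable
with every ideal of `R`. -/
structure IsStrongDivisor {R : Type*} [CommRing R] (x : R) : Prop where
  regular : x ∈ nonZeroDivisors R
  comparable : ∀ I : Ideal R, I ≤ Ideal.span {x} ∨ Ideal.span {x} ≤ I

/-! Over a local `R`, being Prüfer amounts to `MemOrInv`: each `s` in `S` lies in `R` or has its
inverse there. If the maximal ideal `m` satisfies `m R[s] ≠ R[s]`, then `R → R[s]` is a faithfully
flat epimorphism, hence onto. Otherwise `1 ∈ m R[s]` makes `s⁻¹` integral over `R`, and the finite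
epimorphism `R → R[s⁻¹]` is onto. For fractions `a / x`, `MemOrInv` is comparability of `a` and `x`
under divisibility. -/

open Polynomial TensorProduct in
/-- A faithfully flat epimorphism of commutative rings is surjective. -/
theorem Algebra.IsEpi.surjective_of_faithfullyFlat (R T : Type*) [CommRing R] [CommRing T]
    [Algebra R T] [Algebra.IsEpi R T] [Module.FaithfullyFlat R T] :
    Function.Surjective (algebraMap R T) := by
  have h : Function.Surjective (Algebra.linearMap R T) := by
    -- Surjectivity may be tested after tensoring with `T`; there every tensor has the form `t ⊗ 1`,
    -- because multiplication `T ⊗ T → T` is injective.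
    rw [← Module.FaithfullyFlat.lTensor_surjective_iff_surjective R T]
    intro z
    obtain ⟨t, ht⟩ : ∃ t : T, z = t ⊗ₜ[R] (1 : T) := by
      refine ⟨Algebra.TensorProduct.lmul' R z, ?_⟩
      refine Algebra.IsEpi.injective_lift_mul (R := R) (A := T) ?_
      induction z with
      | zero => simp
      | tmul a b => simp
      | add a b ha hb => simp only [map_add, TensorProduct.add_tmul, ha, hb]
    exact ⟨t ⊗ₜ 1, by simp [ht]⟩
  exact h

/-- Every element of the extension `R → S` lies in the image of `R` or is the inverse of an element
of that image. -/
def MemOrInv (R S : Type*) [CommRing R] [CommRing S] [Algebra R S] : Prop :=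
  ∀ t : S, (∃ a : R, algebraMap R S a = t) ∨ ∃ c : R, t * algebraMap R S c = 1

section

variable {R S : Type*} [CommRing R] [CommRing S] [Algebra R S]

theorem MemOrInv.isPruferExtension (hinj : Function.Injective (algebraMap R S))
    (h : MemOrInv R S) : IsPruferExtension R S where
  injective_algebraMap := hinj
  flat T := by
    have hT (t : T) : (∃ a : R, algebraMap R T a = t) ∨ ∃ c : R, t * algebraMap R T c = 1 := by
      refine (h t).imp ?_ ?_
      · rintro ⟨a, ha⟩
        exact ⟨a, Subtype.ext ha⟩
      · rintro ⟨c, hc⟩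
        exact ⟨c, Subtype.ext hc⟩
    -- Flatness: `T` is the localization of `R` at the elements that become units in `T`.
    have hloc : IsLocalization ((IsUnit.submonoid T).comap (algebraMap R T)) T := by
      refine ⟨⟨fun y ↦ y.2, fun t ↦ ?_, fun {x y} hxy ↦ ⟨1, ?_⟩⟩⟩
      · rcases hT t with ⟨a, ha⟩ | ⟨c, hc⟩
        · exact ⟨(a, 1), by simp [ha]⟩
        · have hcu : IsUnit (algebraMap R T c) :=
            IsUnit.of_mul_eq_one t (by rw [mul_comm, hc])
          exact ⟨(1, ⟨c, hcu⟩), by simp [hc]⟩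
      · have : x = y := hinj (congrArg (Subtype.val : T → S) hxy)
        rw [this]
    exact IsLocalization.flat T ((IsUnit.submonoid T).comap (algebraMap R T))
  epi T := by
    rw [Algebra.isEpi_iff_forall_one_tmul_eq]
    intro t
    rcases h t with ⟨a, ha⟩ | ⟨c, hc⟩
    · have : t = algebraMap R T a := Subtype.ext ha.symm
      rw [this, Algebra.algebraMap_eq_smul_one, TensorProduct.smul_tmul]
    · have h1 : c • t = 1 := by
        rw [Algebra.smul_def, mul_comm]
        exact Subtype.ext hc
      conv_lhs => rw [← h1]
      rw [TensorProduct.smul_tmul, h1]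

open Polynomial in
theorem exists_aeval_eq_of_mem_smul_top (I : Ideal R) (s : S) (y : Algebra.adjoin R {s})
    (hy : y ∈ I • (⊤ : Submodule R (Algebra.adjoin R {s}))) :
    ∃ p : R[X], (∀ n, p.coeff n ∈ I) ∧ aeval s p = (y : S) := by
  induction hy using Submodule.smul_induction_on' with
  | smul r hr t _ =>
    obtain ⟨q, hq⟩ := Algebra.adjoin_mem_exists_aeval R s t.2
    exact ⟨C r * q, fun n ↦ by simpa using I.mul_mem_right _ hr, by simp [hq, Algebra.smul_def]⟩
  | add x _ y _ hx hy =>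
    obtain ⟨p, hp, hpx⟩ := hx
    obtain ⟨q, hq, hqy⟩ := hy
    exact ⟨p + q, fun n ↦ by simpa using I.add_mem (hp n) (hq n), by simp [hpx, hqy]⟩

open Polynomial in
/-- A root of a polynomial with unit constant coefficient has an integral inverse. -/
theorem exists_isIntegral_mul_eq_one [Nontrivial R] {s : S} {q : R[X]}
    (hq : IsUnit (q.coeff 0)) (hs : aeval s q = 0) : ∃ u : S, IsIntegral R u ∧ s * u = 1 := by
  have hmul : s * aeval s q.divX + algebraMap R S (q.coeff 0) = 0 := by
    rw [← hs, ← congrArg (aeval s) (X_mul_divX_add q), map_add, map_mul, aeval_X, aeval_C]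
  obtain ⟨w, hw⟩ := hq
  have hsu : s * (-(aeval s q.divX) * algebraMap R S (↑w⁻¹ : R)) = 1 := by
    have hwu : algebraMap R S (q.coeff 0) * algebraMap R S (↑w⁻¹ : R) = 1 := by
      rw [← map_mul, ← hw, Units.mul_inv, map_one]
    linear_combination hwu - algebraMap R S (↑w⁻¹ : R) * hmul
  set u := -(aeval s q.divX) * algebraMap R S (↑w⁻¹ : R)
  refine ⟨u, ?_, hsu⟩
  let _ : Invertible s := ⟨u, by rw [mul_comm, hsu], hsu⟩
  have hrev : eval₂ (algebraMap R S) u q.reverse = 0 :=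
    (eval₂_reverse_eq_zero_iff (algebraMap R S) s q).2 hs
  -- The unit constant coefficient of `q` leads its reverse, so rescaling gives a monic polynomial
  -- killing `u`.
  have h0 : q.coeff 0 ≠ 0 := hw ▸ w.ne_zero
  have hlead : q.reverse.leadingCoeff = w := by
    rw [reverse_leadingCoeff, trailingCoeff, natTrailingDegree_eq_zero.2 (Or.inr h0), hw]
  refine ⟨C (↑w⁻¹ : R) * q.reverse, ?_, by rw [eval₂_mul, hrev, mul_zero]⟩
  exact monic_C_mul_of_mul_leadingCoeff_eq_one (by rw [hlead, Units.inv_mul])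

theorem IsPruferExtension.memOrInv [IsLocalRing R] (h : IsPruferExtension R S) :
    MemOrInv R S := by
  intro s
  have := h.flat (Algebra.adjoin R {s})
  have := h.epi (Algebra.adjoin R {s})
  by_cases hm : IsLocalRing.maximalIdeal R • (⊤ : Submodule R (Algebra.adjoin R {s})) = ⊤
  · have h1 : (1 : Algebra.adjoin R {s}) ∈
        IsLocalRing.maximalIdeal R • (⊤ : Submodule R (Algebra.adjoin R {s})) := by
      rw [hm]
      exact Submodule.mem_top
    obtain ⟨p, hp, hps⟩ := exists_aeval_eq_of_mem_smul_top _ s 1 h1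
    have hunit : IsUnit (1 - p.coeff 0) :=
      (IsLocalRing.isUnit_or_isUnit_one_sub_self (p.coeff 0)).resolve_left
        ((IsLocalRing.mem_maximalIdeal _).1 (hp 0))
    obtain ⟨u, hu, hsu⟩ := exists_isIntegral_mul_eq_one (s := s) (q := 1 - p)
      (by simpa using hunit) (by simp [hps])
    have : Module.Finite R (Algebra.adjoin R {u}) :=
      Module.Finite.iff_fg.2 hu.fg_adjoin_singleton
    have := h.epi (Algebra.adjoin R {u})
    obtain ⟨c, hc⟩ := Algebra.isEpi_iff_surjective_algebraMap_of_finite.1 this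
      ⟨u, Algebra.self_mem_adjoin_singleton R u⟩
    have hc' : algebraMap R S c = u := congrArg Subtype.val hc
    exact Or.inr ⟨c, by rw [hc', hsu]⟩
  · have : Module.FaithfullyFlat R (Algebra.adjoin R {s}) :=
      ⟨fun m hmax ↦ by rwa [IsLocalRing.eq_maximalIdeal hmax]⟩
    obtain ⟨a, ha⟩ := Algebra.IsEpi.surjective_of_faithfullyFlat R (Algebra.adjoin R {s})
      ⟨s, Algebra.self_mem_adjoin_singleton R s⟩
    exact Or.inl ⟨a, congrArg Subtype.val ha⟩

theorem isStrongDivisor_iff {x : R} :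
    IsStrongDivisor x ↔ x ∈ nonZeroDivisors R ∧ ∀ a, x ∣ a ∨ a ∣ x := by
  refine ⟨fun h ↦ ⟨h.regular, fun a ↦ ?_⟩, fun h ↦ ⟨h.1, fun I ↦ ?_⟩⟩
  · simpa only [Ideal.span_singleton_le_span_singleton] using h.comparable (Ideal.span {a})
  · refine or_iff_not_imp_left.2 fun hI ↦ ?_
    obtain ⟨a, ha, hax⟩ := SetLike.not_le_iff_exists.1 hI
    rw [Ideal.span_singleton_le_iff_mem]
    exact I.mem_of_dvd ((h.2 a).resolve_left (mt Ideal.mem_span_singleton.2 hax)) ha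

theorem IsStrongDivisor.pow {x : R} (h : IsStrongDivisor x) (n : ℕ) : IsStrongDivisor (x ^ n) := by
  rw [isStrongDivisor_iff] at h ⊢
  refine ⟨pow_mem h.1 n, ?_⟩
  induction n with
  | zero => simp
  | succ n ih =>
    intro a
    rcases h.2 a with ⟨b, rfl⟩ | hax
    · rw [pow_succ']
      exact (ih b).imp (mul_dvd_mul_left x) (mul_dvd_mul_left x)
    · exact Or.inr (hax.trans (dvd_pow_self x n.succ_ne_zero))

/-- Write `t = a / xⁿ`; powers of `x` are again strong divisors, so `xⁿ` and `a` are comparable. -/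
theorem IsStrongDivisor.memOrInv {x : R} (h : IsStrongDivisor x) [IsLocalization.Away x S] :
    MemOrInv R S := by
  intro t
  obtain ⟨n, a, hn⟩ := IsLocalization.Away.surj x t
  have hu : IsUnit (algebraMap R S (x ^ n)) := by
    rw [map_pow]
    exact (IsLocalization.Away.algebraMap_isUnit x).pow n
  rw [← map_pow] at hn
  rcases (isStrongDivisor_iff.1 (h.pow n)).2 a with ⟨b, rfl⟩ | ⟨c, hc⟩
  · refine Or.inl ⟨b, hu.mul_right_cancel ?_⟩
    rw [hn, map_mul, mul_comm]
  · refine Or.inr ⟨c, hu.mul_right_cancel ?_⟩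
    rw [one_mul, mul_right_comm, hn, ← map_mul, hc]

theorem MemOrInv.isStrongDivisor (hinj : Function.Injective (algebraMap R S)) (h : MemOrInv R S)
    {x : R} (hx : IsUnit (algebraMap R S x)) : IsStrongDivisor x := by
  refine isStrongDivisor_iff.2 ⟨?_, fun a ↦ ?_⟩
  · refine mem_nonZeroDivisors_of_injective hinj hx.mem_nonZeroDivisors
  · obtain ⟨y, hy⟩ := hx.exists_right_inv
    -- The dichotomy is applied to `a / x`.
    rcases h (algebraMap R S a * y) with ⟨b, hb⟩ | ⟨c, hc⟩
    · refine Or.inl ⟨b, hinj ?_⟩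
      rw [map_mul, hb]
      linear_combination (-algebraMap R S a) * hy
    · refine Or.inr ⟨c, hinj ?_⟩
      rw [map_mul]
      linear_combination algebraMap R S a * algebraMap R S c * hy - algebraMap R S x * hc

/-- Each generator has a denominator in `R` that is a unit in `S`; the product of these is `s`, and
some power of it clears the denominator of any given element. -/
theorem MemOrInv.exists_away (hinj : Function.Injective (algebraMap R S)) (h : MemOrInv R S)
    [hfin : Algebra.FiniteType R S] : ∃ s : R, IsLocalization.Away s S := by
  classical
  obtain ⟨G, hG⟩ := hfin.out
  have hden (t : S) : ∃ c : R, IsUnit (algebraMap R S c) ∧ ∃ a, t * algebraMap R S c =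
      algebraMap R S a := by
    rcases h t with ⟨a, ha⟩ | ⟨c, hc⟩
    · exact ⟨1, by simp, a, by simp [ha]⟩
    · exact ⟨c, IsUnit.of_mul_eq_one t (by rw [mul_comm, hc]), 1, by simp [hc]⟩
  choose c hcu a ha using hden
  have hu : IsUnit (algebraMap R S (∏ g ∈ G, c g)) := by
    rw [map_prod]
    exact IsUnit.prod_iff.2 fun g _ ↦ hcu g
  have hpow (t : S) : ∃ n : ℕ, ∃ b : R,
      t * algebraMap R S ((∏ g ∈ G, c g) ^ n) = algebraMap R S b := by
    have ht : t ∈ Algebra.adjoin R (G : Set S) := hG ▸ Algebra.mem_top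
    induction ht using Algebra.adjoin_induction with
    | mem g hg =>
      obtain ⟨d, hd⟩ := Finset.dvd_prod_of_mem c (Finset.mem_coe.1 hg)
      exact ⟨1, a g * d, by rw [pow_one, hd, map_mul, map_mul, ← ha, mul_assoc]⟩
    | algebraMap r => exact ⟨0, r, by simp⟩
    | add x y _ _ hx hy =>
      obtain ⟨m, b, hb⟩ := hx
      obtain ⟨n, d, hd⟩ := hy
      refine ⟨m + n, b * (∏ g ∈ G, c g) ^ n + d * (∏ g ∈ G, c g) ^ m, ?_⟩
      rw [pow_add, map_add, map_mul, map_mul, map_mul, ← hb, ← hd]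
      ring
    | mul x y _ _ hx hy =>
      obtain ⟨m, b, hb⟩ := hx
      obtain ⟨n, d, hd⟩ := hy
      refine ⟨m + n, b * d, ?_⟩
      rw [pow_add, map_mul, map_mul, ← hb, ← hd]
      ring
  refine ⟨∏ g ∈ G, c g, ⟨⟨?_, fun t ↦ ?_, fun {x y} hxy ↦ ⟨1, by rw [hinj hxy]⟩⟩⟩⟩
  · rintro ⟨_, n, rfl⟩
    rw [map_pow]
    exact hu.pow n
  · obtain ⟨n, b, hb⟩ := hpow t
    exact ⟨(b, ⟨_, n, rfl⟩), hb⟩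

end

theorem mainTheorem5 (R : Type*) [CommRing R] [IsLocalRing R] :
    (∀ (S : Type*) [CommRing S] [Algebra R S],
      Function.Injective (algebraMap R S) → Algebra.FiniteType R S →
        (IsPruferExtension R S ↔ ∃ s : R, IsStrongDivisor s ∧ IsLocalization.Away s S)) ∧
    (∀ x : R, x ∈ nonZeroDivisors R →
      (IsStrongDivisor x ↔ IsPruferExtension R (Localization.Away x))) := by
  refine ⟨fun S _ _ hinj _ ↦ ⟨fun h ↦ ?_, ?_⟩, fun x hx ↦ ⟨fun h ↦ ?_, fun h ↦ ?_⟩⟩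
  · obtain ⟨s, hs⟩ := h.memOrInv.exists_away hinj
    exact ⟨s, h.memOrInv.isStrongDivisor hinj (IsLocalization.Away.algebraMap_isUnit s), hs⟩
  · rintro ⟨s, hs, _⟩
    exact hs.memOrInv.isPruferExtension hinj
  · exact h.memOrInv.isPruferExtension
      (IsLocalization.injective _ (Submonoid.powers_le.2 hx))
  · exact h.memOrInv.isStrongDivisor h.injective_algebraMap
      (IsLocalization.Away.algebraMap_isUnit x)
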